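/- All graphs are finite and simple, and a $\mathbb Z_2$-space is a topological space with a continuous involution $\tau$; it is free if $\tau$ has no fixed point, and a continuous map is equivariant if it commutes with the involutions. For graphs $T,G$, a multi-homomorphism from $T$ to $G$ is a map $\varphi\colon V(T)\to 2^{V(G)}\setminus\{\emptyset\}$ such that every function $h\colon V(T)\to V(G)$ with $h(v)\in\varphi(v)$ for all $v$ is a graph homomorphism. $\operatorname{Hom}(T,G)$ is the subcomplex of $\prod_{v\in V(T)}\Delta^{V(G)}$ consisting of the cells $\prod_v\Delta^{\varphi(v)}$, $\varphi$ a multi-homomorphism, and $|\operatorname{Hom}(T,G)|$ is its underlying space. The space $|\operatorname{Hom}(K_2,G)|$ carries the involution induced by $v\mapsto 1-v$ on $V(K_2)=\{0,1\}$, and $|\operatorname{Hom}(C_{2r+1},G)|$, for the cycle $C_{2r+1}$ on $\{0,\dots,2r\}$ with $r\ge 1$, the involution induced by $v\mapsto 2r-v$. Let $S^1_b\subset\mathbb R^2$ be the unit circle with the left action $\tau\cdot s=-s$ and the right action $(s_0,s_1)\cdot\tau=(-s_0,s_1)$ of $\mathbb Z_2=\{1,\tau\}$. For a $\mathbb Z_2$-space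 $X$ let $$S^1_b\times_{\mathbb Z_2}X=(S^1_b\times X)/\bigl((s,\tau x)\sim(s\tau,x)\bigr),$$ with the quotient topology and the involution $[(s,x)]\mapsto[(-s,x)]$. **Proposition.** Let $G$ be a graph, let $X$ be a compact triangulable free $\mathbb Z_2$-space, and let $f\colon S^1_b\times_{\mathbb Z_2}X\to|\operatorname{Hom}(K_2,G)|$ be an equivariant continuous map. Then there exist an $r\ge 1$ and an equivariant continuous map $g\colon X\to|\operatorname{Hom}(C_{2r+1},G)|$. -/

import Mathlib

noncomputable section

/-! ### Spaces with an involution -/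

/-- A `ℤ₂`-action on a topological space, given by the action of the generator:
a continuous involution. -/
structure Z2Action (X : Type*) [TopologicalSpace X] where
  /-- the action of the generator -/
  act : X → X
  continuous_act : Continuous act
  act_act : ∀ x, act (act x) = x

/-- A `ℤ₂`-action is free if its generator has no fixed point. -/
def Z2Action.IsFree {X : Type*} [TopologicalSpace X] (τ : Z2Action X) : Prop :=
  ∀ x, τ.act x ≠ x

/-- A continuous map is equivariant if it commutes with the generators. -/
def IsEquivariant {X Y : Type*} [TopologicalSpace X] [TopologicalSpace Y]
    (τX : Z2Action X) (τY : Z2Action Y) (f : C(X, Y)) : Prop :=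
  ∀ x, f (τX.act x) = τY.act (f x)

/-- A space is compact and triangulable if it is homeomorphic to the underlying space of a finite
geometric simplicial complex in some `ℝⁿ`. (A simplicial complex with compact realization is
finite, and every finite complex embeds in some `ℝⁿ`.) -/
def IsCompactTriangulable (X : Type*) [TopologicalSpace X] : Prop :=
  ∃ (n : ℕ) (K : Geometry.SimplicialComplex ℝ (EuclideanSpace ℝ (Fin n))),
    K.faces.Finite ∧ Nonempty (X ≃ₜ K.space)

/-! ### The circle with its two actions and the twisted product -/

/-- The unit circle in the Euclidean plane. -/
abbrev Circle1 : Type := Metric.sphere (0 : EuclideanSpace ℝ (Fin 2)) 1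

/-- The reflection `(x₀, x₁) ↦ (-x₀, x₁)`, the right action of the generator of `ℤ₂` on the
circle. The left action is the antipodal map `s ↦ -s`. -/
def Circle1.reflect (s : Circle1) : Circle1 :=
  ⟨!₂[-(s.1 0), s.1 1], by
    have h := s.2
    simp only [mem_sphere_zero_iff_norm, EuclideanSpace.norm_eq, Fin.sum_univ_two] at h ⊢
    simpa using h⟩

/-- The relation `(s, τ x) ∼ (s τ, x)` on `S¹ × X`. -/
def TwistedRel {X : Type*} [TopologicalSpace X] (τ : Z2Action X) (p q : Circle1 × X) : Prop :=
  ∃ s x, p = (s, τ.act x) ∧ q = (Circle1.reflect s, x)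

/-- The twisted product `S¹_b ×_{ℤ₂} X`, the quotient of `S¹ × X` by the equivalence relation
generated by `(s, τ x) ∼ (s τ, x)`. -/
def TwistedProduct {X : Type*} [TopologicalSpace X] (τ : Z2Action X) : Type _ :=
  Quot (TwistedRel τ)

/-- The quotient topology. -/
instance TwistedProduct.topologicalSpace {X : Type*} [TopologicalSpace X] (τ : Z2Action X) :
    TopologicalSpace (TwistedProduct τ) :=
  inferInstanceAs (TopologicalSpace (Quot (TwistedRel τ)))

theorem Circle1.reflect_neg (s : Circle1) :
    Circle1.reflect (-s) = -Circle1.reflect s := by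
  apply Subtype.ext
  ext i
  fin_cases i <;> simp [Circle1.reflect]

/-- The `ℤ₂`-action `[(s, x)] ↦ [(-s, x)]` on the twisted product. -/
def TwistedProduct.action {X : Type*} [TopologicalSpace X] (τ : Z2Action X) :
    Z2Action (TwistedProduct τ) where
  act := Quot.map (fun p => (-p.1, p.2)) (by
    rintro _ _ ⟨s, x, rfl, rfl⟩
    exact ⟨-s, x, rfl, by simp [Circle1.reflect_neg]⟩)
  continuous_act := by
    refine continuous_quot_lift _ ?_
    exact continuous_quot_mk.comp (by fun_prop)
  act_act := by
    rintro ⟨s, x⟩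
    exact congrArg (Quot.mk _) (by simp)

/-! ### Hom complexes of graphs -/

/-- A multi-homomorphism from `T` to `G`: a family of non-empty vertex sets of `G`, all of whose
choice functions are graph homomorphisms. -/
def IsMultiHom {U V : Type*} (T : SimpleGraph U) (G : SimpleGraph V) (φ : U → Set V) : Prop :=
  (∀ u, (φ u).Nonempty) ∧
    ∀ f : U → V, (∀ u, f u ∈ φ u) → ∀ u u', T.Adj u u' → G.Adj (f u) (f u')

/-- The underlying space of the cell complex `Hom(T, G)`: the union, inside the product of
simplices `∏_{u ∈ V(T)} Δ^{V(G)}`, of the closed cells `∏_u Δ^{φ(u)}` over all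
multi-homomorphisms `φ`. -/
def HomComplex {U V : Type*} [Fintype V] (T : SimpleGraph U) (G : SimpleGraph V) : Type _ :=
  {x : U → stdSimplex ℝ V //
    ∃ φ : U → Set V, IsMultiHom T G φ ∧ ∀ u w, (x u).1 w ≠ 0 → w ∈ φ u}

/-- The subspace topology. -/
instance HomComplex.topologicalSpace {U V : Type*} [Fintype V] (T : SimpleGraph U) (G : SimpleGraph V) :
    TopologicalSpace (HomComplex T G) :=
  inferInstanceAs (TopologicalSpace {x : U → stdSimplex ℝ V //
    ∃ φ : U → Set V, IsMultiHom T G φ ∧ ∀ u w, (x u).1 w ≠ 0 → w ∈ φ u})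

/-- The `ℤ₂`-action `x ↦ x ∘ α` on `Hom(T, G)` induced by an involution `α` of the graph `T`. -/
def HomComplex.action {U V : Type*} [Fintype V] {T : SimpleGraph U} (G : SimpleGraph V)
    (α : T ≃g T) (hα : ∀ u, α (α u) = u) : Z2Action (HomComplex T G) where
  act x := ⟨fun u => x.1 (α u), by
    obtain ⟨φ, ⟨hne, hφ⟩, hx⟩ := x.2
    refine ⟨fun u => φ (α u), ⟨fun u => hne _, fun f hf u u' h => ?_⟩, fun u w => hx (α u) w⟩
    have := hφ (fun u => f (α u)) (fun u => by simpa [hα] using hf (α u)) (α u) (α u')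
      (α.map_adj_iff.2 h)
    simpa [hα] using this⟩
  continuous_act := by
    refine Continuous.subtype_mk (continuous_pi fun u => ?_) _
    exact (continuous_apply (α u)).comp continuous_subtype_val
  act_act x := Subtype.ext (funext fun u => congrArg x.1 (hα u))

/-- The complete graph `K₂` on `{0, 1}`. -/
abbrev K2 : SimpleGraph (Fin 2) := ⊤

/-- The involution `v ↦ 1 - v` of `K₂`. -/
def K2.flip : K2 ≃g K2 where
  toEquiv := Fin.revPerm
  map_rel_iff' := by simp [K2]

/-- The involution `v ↦ n - 1 - v` of the cycle `Cₙ` on `{0, …, n - 1}`. -/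
def cycleFlip (n : ℕ) : SimpleGraph.cycleGraph n ≃g SimpleGraph.cycleGraph n where
  toEquiv := Fin.revPerm
  map_rel_iff' := by
    intro a b
    rw [SimpleGraph.cycleGraph_adj', SimpleGraph.cycleGraph_adj']
    have key : ∀ c d : Fin n, Fin.rev c - Fin.rev d = d - c := by
      intro c d
      apply Fin.ext
      simp only [Fin.sub_def, Fin.val_rev]
      congr 1
      omega
    simp only [Fin.revPerm_apply, key]
    exact or_comm

/-- The `ℤ₂`-action on `Hom(K₂, G)` induced by the flip of `K₂`. -/
def homK2Action {V : Type*} [Fintype V] (G : SimpleGraph V) : Z2Action (HomComplex K2 G) :=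
  HomComplex.action G K2.flip Fin.rev_rev

/-- The `ℤ₂`-action on `Hom(Cₙ, G)` induced by the involution `v ↦ n - 1 - v` of `Cₙ`. -/
def homCycleAction {V : Type*} [Fintype V] (G : SimpleGraph V) (n : ℕ) :
    Z2Action (HomComplex (SimpleGraph.cycleGraph n) G) :=
  HomComplex.action G (cycleFlip n) Fin.rev_rev

end

/-!
By equivariance, the map `f` is determined by `a(s, x)`, the first coordinate of `f [(s, x)]`:
the second one is `a(-s, x)`. So `a : S¹ × X → Δ^V` satisfies `a(s, τ x) = a(s τ, x)`, and every
vertex in the support of `a(s, x)` is adjacent to every vertex in the support of `a(-s, x)`.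

Put `n = 2r + 1` and walk around the circle in `n` steps of angle `π + π / n`, placing the middle
step at `(0, 1)`. The total angle is `(2r + 2) π`, so the walk closes up, and it is carried to its
reverse by the reflection. Sampling `a(·, x)` along it gives `n` points of `Δ^V`, cyclically
indexed, which the involution of `X` reverses. Each sample point is close to the antipode of its
predecessor, but supports do not vary continuously, so consecutive supports need not be completely
joined. This is repaired by truncation: lower all barycentric coordinates by `1 / (|V| + 1)`,
cut off at `0` and normalize. The support of the truncation of `p` lies in the support of every `q`
whose coordinates are within `1 / (|V| + 1)` of those of `p` (`ne_zero_of_truncate_ne_zero`).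
By compactness of `X`, the function `a` is uniformly continuous along the circle, so for large `r`
the truncated support of each sample lies in the support of `a` at the antipode of the preceding
sample point, and the truncated samples form a point of `Hom(C_{2r+1}, G)`.
-/

open Real

/-! ### Compactness of triangulable spaces -/

theorem IsCompactTriangulable.compactSpace {X : Type*} [TopologicalSpace X]
    (hX : IsCompactTriangulable X) : CompactSpace X := by
  obtain ⟨n, K, hK, ⟨e⟩⟩ := hX
  have hc : IsCompact K.space :=
    hK.isCompact_biUnion fun s _ => s.finite_toSet.isCompact_convexHull (𝕜 := ℝ)
  have := isCompact_iff_compactSpace.1 hc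
  exact e.symm.compactSpace

/-! ### Truncation of barycentric coordinates -/

section Truncation

variable {V : Type*} [Fintype V]

/-- The sum of the barycentric coordinates lowered by `1 / (|V| + 1)` and cut off at `0`. -/
noncomputable def truncatedMass (p : stdSimplex ℝ V) : ℝ :=
  ∑ v, max (p.1 v - 1 / (Fintype.card V + 1)) 0

/-- As `1 / (|V| + 1)` is below the mean of the coordinates, some coordinate survives. -/
theorem truncatedMass_pos (p : stdSimplex ℝ V) : 0 < truncatedMass p := by
  have h1 : ∑ v, (p.1 v - 1 / (Fintype.card V + 1 : ℝ)) ≤ truncatedMass p :=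
    Finset.sum_le_sum fun v _ => le_max_left _ _
  refine lt_of_lt_of_le ?_ h1
  rw [Finset.sum_sub_distrib, p.2.2, Finset.sum_const, Finset.card_univ, nsmul_eq_mul, sub_pos,
    mul_one_div, div_lt_one (by positivity)]
  exact lt_add_one _

/-- The retraction of the simplex that lowers all barycentric coordinates by `1 / (|V| + 1)`, cuts
them off at `0` and normalizes. -/
noncomputable def truncate (p : stdSimplex ℝ V) : stdSimplex ℝ V :=
  ⟨fun v => max (p.1 v - 1 / (Fintype.card V + 1)) 0 / truncatedMass p,
    fun _ => div_nonneg (le_max_right _ _) (truncatedMass_pos p).le, by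
      rw [← Finset.sum_div]
      exact div_self (truncatedMass_pos p).ne'⟩

theorem continuous_truncate : Continuous (truncate (V := V)) := by
  have hv : ∀ v : V, Continuous fun p : stdSimplex ℝ V => p.1 v := fun v =>
    (continuous_apply v).comp continuous_subtype_val
  have hm : ∀ v : V, Continuous fun p : stdSimplex ℝ V =>
      max (p.1 v - 1 / (Fintype.card V + 1 : ℝ)) 0 := fun v =>
    ((hv v).sub continuous_const).max continuous_const
  exact Continuous.subtype_mk (continuous_pi fun v =>
    (hm v).div (continuous_finsetSum _ fun v _ => hm v) fun p => (truncatedMass_pos p).ne') _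

theorem ne_zero_of_truncate_ne_zero {p q : stdSimplex ℝ V}
    (h : dist p q < 1 / (Fintype.card V + 1)) {v : V} (hv : (truncate p).1 v ≠ 0) :
    q.1 v ≠ 0 := by
  intro hq
  refine hv ?_
  have h1 : dist (p.1 v) (q.1 v) ≤ dist p q := dist_le_pi_dist p.1 q.1 v
  rw [hq, dist_zero_right] at h1
  have h2 : p.1 v - 1 / (Fintype.card V + 1 : ℝ) ≤ 0 := by
    linarith [le_abs_self (p.1 v), Real.norm_eq_abs (p.1 v)]
  simp only [truncate, max_eq_right h2, zero_div]

end Truncation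

/-! ### The circle -/

/-- The point of the circle with a given angle. -/
noncomputable def Circle1.ofAngle (t : ℝ) : Circle1 :=
  ⟨!₂[cos t, sin t], by simp [EuclideanSpace.norm_eq, Fin.sum_univ_two]⟩

namespace Circle1

theorem ofAngle_add_pi (t : ℝ) : ofAngle (t + π) = -ofAngle t := by
  apply Subtype.ext
  ext i
  fin_cases i <;> simp [ofAngle]

theorem ofAngle_sub_nat_mul_two_pi (t : ℝ) (k : ℕ) : ofAngle (t - k * (2 * π)) = ofAngle t := by
  simp [ofAngle, cos_sub_nat_mul_two_pi, sin_sub_nat_mul_two_pi]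

theorem reflect_ofAngle (t : ℝ) : reflect (ofAngle t) = ofAngle (π - t) := by
  simp [ofAngle, reflect]

theorem uniformContinuous_ofAngle : UniformContinuous ofAngle := by
  refine UniformContinuous.subtype_mk ?_ _
  refine (PiLp.uniformContinuous_toLp 2 _).comp (uniformContinuous_pi.2 fun i => ?_)
  fin_cases i
  · exact Real.lipschitzWith_cos.uniformContinuous
  · exact Real.lipschitzWith_sin.uniformContinuous

end Circle1

/-! ### Samples along an odd walk around the circle -/

/-- The angle of the `k`-th point of the walk of `2 r + 1` steps of angle `π + π / (2 r + 1)`, the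
`r`-th point being `(0, 1)`. -/
noncomputable def walkAngle (r : ℕ) (k : Fin (2 * r + 1)) : ℝ :=
  π / 2 + ((k : ℝ) - r) * (π + π / (2 * r + 1))

theorem walkAngle_rev (r : ℕ) (k : Fin (2 * r + 1)) :
    walkAngle r k.rev = π - walkAngle r k := by
  have h : ((k.rev : ℕ) : ℝ) = 2 * r - k := by
    rw [eq_sub_iff_add_eq]
    have : (k.rev : ℕ) + k = 2 * r := by rw [Fin.val_rev]; omega
    exact_mod_cast this
  rw [walkAngle, walkAngle, h]
  ring

/-- Each step of the walk, including the one that closes it up, leads to the point at angle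
`π / (2 r + 1)` from the antipode. -/
theorem ofAngle_walkAngle_of_sub_eq_one {r : ℕ} {i j : Fin (2 * r + 1)}
    (h : (j - i : Fin (2 * r + 1)).val = 1) :
    Circle1.ofAngle (walkAngle r j) =
      Circle1.ofAngle (walkAngle r i + π + π / (2 * r + 1)) := by
  have hi := i.2
  have hj := j.2
  have hcases : (j : ℕ) = i + 1 ∨ (j : ℕ) = 0 ∧ (i : ℕ) = 2 * r := by
    rw [Fin.sub_def] at h
    simp only at h
    rcases lt_or_ge (2 * r + 1 - (i : ℕ) + j) (2 * r + 1) with hlt | hge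
    · rw [Nat.mod_eq_of_lt hlt] at h
      omega
    · rw [Nat.mod_eq_sub_mod hge, Nat.mod_eq_of_lt (by omega)] at h
      omega
  rcases hcases with hji | ⟨hj0, hir⟩
  · congr 1
    rw [walkAngle, walkAngle, hji]
    push_cast
    ring
  · rw [← Circle1.ofAngle_sub_nat_mul_two_pi (walkAngle r i + _ + _) (r + 1)]
    congr 1
    rw [walkAngle, walkAngle, hj0, hir]
    have : (2 * r + 1 : ℝ) ≠ 0 := by positivity
    push_cast
    field_simp
    ring

/-- For a compact parameter space, any map on `S¹ × X` moves by little, uniformly, under rotation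
by `π / (2 r + 1)` for large `r`. -/
theorem exists_forall_dist_ofAngle_lt {X Y : Type*} [TopologicalSpace X] [CompactSpace X]
    [PseudoMetricSpace Y] (a : C(Circle1 × X, Y)) {ε : ℝ} (hε : 0 < ε) :
    ∃ r : ℕ, 1 ≤ r ∧ ∀ (t : ℝ) (x : X),
      dist (a (Circle1.ofAngle (t + π / (2 * r + 1)), x)) (a (Circle1.ofAngle t, x)) < ε := by
  have hu : UniformContinuous fun t => a.curry (Circle1.ofAngle t) :=
    (CompactSpace.uniformContinuous_of_continuous a.curry.continuous).comp
      Circle1.uniformContinuous_ofAngle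
  obtain ⟨δ, hδ, h⟩ := Metric.uniformContinuous_iff.1 hu ε hε
  obtain ⟨m, hm⟩ := exists_nat_gt (π / δ)
  refine ⟨m + 1, by omega, fun t x => ?_⟩
  refine (ContinuousMap.dist_apply_le_dist x).trans_lt (h ?_)
  have hm0 : (0 : ℝ) ≤ m := m.cast_nonneg
  have hpos : (0 : ℝ) < 2 * ((m + 1 : ℕ) : ℝ) + 1 := by positivity
  rw [Real.dist_eq, add_sub_cancel_left, abs_of_pos (div_pos pi_pos hpos), div_lt_comm₀ hpos hδ]
  push_cast
  linarith

/-! ### Spaces of edges and spaces of circuits -/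

theorem HomComplex.adj_of_ne_zero {U V : Type*} [Fintype V] {T : SimpleGraph U}
    {G : SimpleGraph V} (p : HomComplex T G) {u u' : U} (h : T.Adj u u') {v w : V}
    (hv : (p.1 u).1 v ≠ 0) (hw : (p.1 u').1 w ≠ 0) : G.Adj v w := by
  classical
  obtain ⟨φ, ⟨hne, hφ⟩, hp⟩ := p.2
  choose c hc using hne
  have key := hφ (Function.update (Function.update c u v) u' w) (fun z => by
    by_cases hz' : z = u'
    · subst hz'
      simpa using hp _ _ hw
    · by_cases hz : z = u
      · subst hz
        simpa [hz'] using hp _ _ hv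
      · simpa [hz, hz'] using hc z) u u' h
  simpa [h.ne] using key

/-- Points of simplices form a point of `Hom(T, G)` once their supports over adjacent vertices of
`T` are completely joined; the supports themselves are the multi-homomorphism. -/
theorem exists_isMultiHom_of_adj {U V : Type*} [Fintype V] {T : SimpleGraph U} {G : SimpleGraph V}
    (p : U → stdSimplex ℝ V)
    (h : ∀ u u', T.Adj u u' → ∀ v w, (p u).1 v ≠ 0 → (p u').1 w ≠ 0 → G.Adj v w) :
    ∃ φ : U → Set V, IsMultiHom T G φ ∧ ∀ u w, (p u).1 w ≠ 0 → w ∈ φ u := by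
  refine ⟨fun u => {w | (p u).1 w ≠ 0}, ⟨fun u => ?_, fun c hc u u' hu => ?_⟩, fun _ _ hw => hw⟩
  · by_contra hne
    rw [Set.not_nonempty_iff_eq_empty, Set.eq_empty_iff_forall_notMem] at hne
    have hs := (p u).2.2
    rw [Finset.sum_eq_zero fun w _ => not_not.1 (hne w)] at hs
    exact zero_ne_one hs
  · exact h u u' hu _ _ (hc u) (hc u')

theorem mainTheorem9 {V : Type*} [Fintype V] (G : SimpleGraph V)
    {X : Type*} [TopologicalSpace X] (hX : IsCompactTriangulable X)
    (τ : Z2Action X) (hτ : τ.IsFree)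
    (f : C(TwistedProduct τ, HomComplex K2 G))
    (hf : IsEquivariant (TwistedProduct.action τ) (homK2Action G) f) :
    ∃ r : ℕ, 1 ≤ r ∧
      ∃ g : C(X, HomComplex (SimpleGraph.cycleGraph (2 * r + 1)) G),
        IsEquivariant τ (homCycleAction G (2 * r + 1)) g := by
  have := hX.compactSpace
  let mk : Circle1 × X → TwistedProduct τ := Quot.mk _
  have hmk : Continuous mk := continuous_quot_mk
  let a : C(Circle1 × X, stdSimplex ℝ V) :=
    ⟨fun p => (f (mk p)).1 0,
      (continuous_apply 0).comp (continuous_subtype_val.comp (f.continuous.comp hmk))⟩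
  have ha_neg : ∀ s x, a (-s, x) = (f (mk (s, x))).1 1 := fun s x =>
    congrArg (fun p : HomComplex K2 G => p.1 0) (hf (mk (s, x)))
  have ha_act : ∀ s x, a (s, τ.act x) = a (s.reflect, x) := fun s x =>
    congrArg (fun p => (f p).1 0) (Quot.sound ⟨s, x, rfl, rfl⟩)
  have ha_adj : ∀ s x v w, (a (s, x)).1 v ≠ 0 → (a (-s, x)).1 w ≠ 0 → G.Adj v w := by
    intro s x v w hv hw
    rw [ha_neg] at hw
    exact (f (mk (s, x))).adj_of_ne_zero (u := 0) (u' := 1) (by simp) hv hw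
  have hε : (0 : ℝ) < 1 / (Fintype.card V + 1) := by positivity
  obtain ⟨r, hr, hclose⟩ := exists_forall_dist_ofAngle_lt a hε
  let b : Fin (2 * r + 1) → X → stdSimplex ℝ V := fun i x =>
    truncate (a (Circle1.ofAngle (walkAngle r i), x))
  have hstep : ∀ i j : Fin (2 * r + 1), (j - i : Fin (2 * r + 1)).val = 1 → ∀ x v w,
      (b i x).1 v ≠ 0 → (b j x).1 w ≠ 0 → G.Adj v w := by
    intro i j hij x v w hv hw
    refine ha_adj (Circle1.ofAngle (walkAngle r i)) x v w
      (ne_zero_of_truncate_ne_zero (by simpa using hε) hv) ?_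
    refine ne_zero_of_truncate_ne_zero ?_ hw
    rw [ofAngle_walkAngle_of_sub_eq_one hij, ← Circle1.ofAngle_add_pi]
    exact hclose _ x
  have hmem : ∀ x, ∃ φ : Fin (2 * r + 1) → Set V,
      IsMultiHom (SimpleGraph.cycleGraph (2 * r + 1)) G φ ∧
        ∀ i w, (b i x).1 w ≠ 0 → w ∈ φ i := by
    refine fun x => exists_isMultiHom_of_adj (fun i => b i x) fun i j hij v w hv hw => ?_
    rcases SimpleGraph.cycleGraph_adj'.1 hij with h | h
    · exact (hstep j i h x w v hw hv).symm
    · exact hstep i j h x v w hv hw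
  refine ⟨r, hr, ⟨fun x => ⟨fun i => b i x, hmem x⟩, ?_⟩, fun x => ?_⟩
  · refine Continuous.subtype_mk (continuous_pi fun i => ?_) _
    exact continuous_truncate.comp (a.continuous.comp (by fun_prop))
  · refine Subtype.ext (funext fun i => ?_)
    change truncate (a (_, τ.act x)) = truncate (a (Circle1.ofAngle (walkAngle r i.rev), x))
    rw [ha_act, Circle1.reflect_ofAngle, walkAngle_rev]
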